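/- Let $P\subset\mathbb R^2$ be a nondegenerate convex polygon. For a point $x$ outside $P$ let $Tx$ be the reflection of $x$ in the point where the right tangent from $x$ touches $P$ (seen from $x$, the polygon lies to the left of this tangent); $Tx$ is undefined if this tangent touches $P$ along a side. A point $x$ outside $P$ has a finite orbit if $T^n x$ is undefined for some $n$, and is periodic if $T^n x=x$ for some $n\ge 1$. Let $A_0$ be the set of points outside $P$ with a finite orbit; the components are the connected components of $(\mathbb R^2\setminus P)\setminus A_0$. Call $P$ a lattice polygon if it is the image of a polygon with rational vertices under an affine bijection of the plane. Let $P$ be a lattice polygon. Then: 1. every point outside $P$ whose orbit is not finite is periodic (there are no infinite aperiodic orbits); 2. every component $C$ is the interior of a nondegenerate convex polygon and is periodic: every point of $C$ is periodic, and there is $n\ge 1$, depending only on $C$, with $T^n y=y$ for all $y\in C$. Moreover, every regular triangle, every square and every regular hexagon is a lattice polygon, so that 1 and 2 hold for them. -/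

import Mathlib

noncomputable section

namespace OuterBilliard

/-- The Euclidean plane. -/
abbrev Plane : Type := EuclideanSpace ℝ (Fin 2)

/-- The oriented area of the parallelogram spanned by `a` and `b`. -/
def cross (a b : Plane) : ℝ := a 0 * b 1 - a 1 * b 0

/-- `V` is the vertex set of a (nondegenerate, convex) polygon: finitely many points in convex
position, not all on one line. The polygon itself is `convexHull ℝ V`. -/
structure IsConvexPolygon (V : Set Plane) : Prop where
  finite : V.Finite
  convexIndependent : ConvexIndependent ℝ ((↑) : V → Plane)
  not_collinear : ¬ Collinear ℝ V

/-- A lattice polygon: some affine bijection of the plane makes all vertices rational. -/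
def IsLatticePolygon (V : Set Plane) : Prop :=
  IsConvexPolygon V ∧
    ∃ f : Plane ≃ᵃ[ℝ] Plane, ∀ v ∈ V, ∀ i : Fin 2, ∃ q : ℚ, f v i = (q : ℝ)

/-- `V` is the vertex set of a regular `n`-gon (any centre `c`, circumradius `r` and
rotation angle `θ`). -/
def IsRegularPolygon (n : ℕ) (V : Set Plane) : Prop :=
  ∃ (c : Plane) (r θ : ℝ), 0 < r ∧
    V = Set.range fun k : Fin n =>
      c + r • (!₂[Real.cos (θ + 2 * Real.pi * (k : ℕ) / n),
                  Real.sin (θ + 2 * Real.pi * (k : ℕ) / n)] : Plane)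

/-- The points outside the table. -/
def exterior (V : Set Plane) : Set Plane := (convexHull ℝ V)ᶜ

/-- `v` is the only point in which the right tangent from `x` touches the polygon: seen from `x`,
every other vertex lies strictly to the left of the ray from `x` through `v`. -/
def IsRightTangentPoint (V : Set Plane) (x v : Plane) : Prop :=
  v ∈ V ∧ ∀ w ∈ V, w ≠ v → 0 < cross (v - x) (w - x)

theorem IsRightTangentPoint.unique {V : Set Plane} {x v w : Plane}
    (hv : IsRightTangentPoint V x v) (hw : IsRightTangentPoint V x w) : v = w := by
  by_contra h
  have h1 := hv.2 w hw.1 (Ne.symm h)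
  have h2 := hw.2 v hv.1 h
  unfold cross at h1 h2
  linarith

open Classical in
/-- The outer billiard map `T`: a point `x` outside the table is reflected in its right tangent
point; `none` means undefined, i.e. the right tangent touches the table along a side. -/
def T (V : Set Plane) (x : Plane) : Option Plane :=
  if h : x ∈ exterior V ∧ ∃ v, IsRightTangentPoint V x v then
    some (Equiv.pointReflection h.2.choose x)
  else none

theorem T_eq_some_iff {V : Set Plane} {x y : Plane} :
    T V x = some y ↔
      x ∈ exterior V ∧ ∃ v, IsRightTangentPoint V x v ∧ y = Equiv.pointReflection v x := by
  unfold T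
  split_ifs with h
  · rw [Option.some.injEq]
    constructor
    · intro e
      exact ⟨h.1, h.2.choose, h.2.choose_spec, e.symm⟩
    · rintro ⟨-, v, hv, rfl⟩
      rw [h.2.choose_spec.unique hv]
  · constructor
    · intro e
      cases e
    · rintro ⟨h1, v, hv, -⟩
      exact absurd ⟨h1, v, hv⟩ h

/-- The partially defined iterates `T ^ n`. -/
def iterT (V : Set Plane) : ℕ → Plane → Option Plane
  | 0, x => some x
  | n + 1, x => (iterT V n x).bind (T V)

/-- The set `A₀` of points outside the table with a finite orbit. -/
def finitePoints (V : Set Plane) : Set Plane :=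
  {x | x ∈ exterior V ∧ ∃ n : ℕ, iterT V n x = none}

/-- The set of periodic points outside the table. -/
def periodicPoints (V : Set Plane) : Set Plane :=
  {x | x ∈ exterior V ∧ ∃ n : ℕ, 0 < n ∧ iterT V n x = some x}

/-- `C` is one of the components into which `A₀` divides the exterior of the table. -/
def IsComponent (V C : Set Plane) : Prop :=
  ∃ x ∈ exterior V \ finitePoints V, C = connectedComponentIn (exterior V \ finitePoints V) x

/-- `C` is a nondegenerate open convex polygon. -/
def IsOpenPolygon (C : Set Plane) : Prop :=
  ∃ W : Set Plane, IsConvexPolygon W ∧ C = interior (convexHull ℝ W)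

end OuterBilliard

end

/-!
The proof measures everything by the oriented area `cross`. If the vertices have rational
coordinates in some affine frame, the areas spanned by differences of vertices are integer
multiples of one `δ > 0` (`IsLatticePolygon.exists_areaDiscrete`), and only this is used about the
lattice.

**Orbits are bounded.** Let `x` have tangent point `v` and let its image have tangent point `w`.
The square of the map translates `x` by `2 • (w - v)`, and `cross (w - v) (x - v)` is a measure of
the distance of `x` from the polygon (`exists_norm_le_of_cross_le`) which does not change along the
orbit while the tangent points alternate between `v` and `w`. Far from the polygon the tangent
points change only in strips bounded by the line of a side and its reflection in a farthest vertex
`w`, and the line of the side contains both the old tangent point `v` and the new one `v'`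
(`AreaDiscrete.exists_forall_side`). For suitable arbitrarily large `K` there is a necklace: a
closed chain of translates of the polygon and of its point reflections (beads) which lies along the
level lines of size `K` and is permuted by the map. Divisibility of `K` by all areas makes the
chain close up and puts the beads in the right position in every strip (`IsBeadShift`,
`IsCommonMultiple.isBeadShift`). A point that is inside the level line for the pair `v`, `w` but
outside that for `v'`, `w` lies in the triangle cut out of a bead
(`sub_mem_convexHull_of_cross_le`). Hence no orbit crosses the necklace
(`IsCommonMultiple.confined_of_confined`), and since `K` can be taken large, every orbit is bounded
(`IsOrbit.exists_norm_le`).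

**Orbits are periodic.** The points of even index of an orbit differ by elements of a lattice, so
that a bounded orbit takes some value twice; the map being injective, it is periodic
(`IsOrbit.exists_period`).

**Components are polygons.** The points that share the first `2 * n` tangent points with a given
point of period `2 * n` form a finite intersection of open half-planes on which the `2 * n`-th
iterate is the identity. This cell is relatively closed in the set of points with infinite orbits
(`mem_cell_of_mem_closure`), so it is the component. It is bounded, as a point far away cannot come
back in `2 * n` steps (`isBounded_cell`), and a bounded finite intersection of half-planes is a
polygon by the Krein–Milman theorem (`isOpenPolygon_halfPlanes`).

**Regular polygons.** Consecutive vertices of a regular `n`-gon with centre `0` satisfy `u (k + 2)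
= 2 cos (2π / n) • u (k + 1) - u k`, and `2 cos (2π / n)` is an integer for `n = 3, 4, 6`.
-/

open Set Filter Topology

namespace OuterBilliard

/-! ### The oriented area -/

theorem cross_add_left (a b c : Plane) : cross (a + b) c = cross a c + cross b c := by
  simp only [cross, PiLp.add_apply]; ring

theorem cross_add_right (a b c : Plane) : cross a (b + c) = cross a b + cross a c := by
  simp only [cross, PiLp.add_apply]; ring

theorem cross_sub_right (a b c : Plane) : cross a (b - c) = cross a b - cross a c := by
  simp only [cross, PiLp.sub_apply]; ring

theorem cross_smul_left (t : ℝ) (a b : Plane) : cross (t • a) b = t * cross a b := by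
  simp only [cross, PiLp.smul_apply, smul_eq_mul]; ring

theorem cross_smul_right (t : ℝ) (a b : Plane) : cross a (t • b) = t * cross a b := by
  simp only [cross, PiLp.smul_apply, smul_eq_mul]; ring

theorem cross_neg_left (a b : Plane) : cross (-a) b = -cross a b := by
  simp only [cross, PiLp.neg_apply]; ring

theorem cross_neg_right (a b : Plane) : cross a (-b) = -cross a b := by
  simp only [cross, PiLp.neg_apply]; ring

theorem cross_self (a : Plane) : cross a a = 0 := by
  simp only [cross]; ring

theorem cross_zero_left (a : Plane) : cross 0 a = 0 := by simp [cross]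

theorem cross_zero_right (a : Plane) : cross a 0 = 0 := by simp [cross]

theorem cross_swap (a b : Plane) : cross b a = -cross a b := by
  simp only [cross]; ring

/-- Any three vectors of the plane satisfy this linear relation. -/
theorem cross_smul_add_cross_smul_add_cross_smul (a b c : Plane) :
    cross b c • a + cross c a • b + cross a b • c = 0 := by
  ext i
  fin_cases i <;>
  · simp only [cross, PiLp.add_apply, PiLp.smul_apply, smul_eq_mul, PiLp.zero_apply]
    simp
    ring

theorem abs_cross_le (a b : Plane) : |cross a b| ≤ ‖a‖ * ‖b‖ := by
  rw [EuclideanSpace.norm_eq, EuclideanSpace.norm_eq, ← Real.sqrt_mul (by positivity)]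
  apply Real.abs_le_sqrt
  simp only [Fin.sum_univ_two, Real.norm_eq_abs, sq_abs, cross]
  nlinarith [sq_nonneg (a 0 * b 0 + a 1 * b 1)]

theorem continuous_cross {X : Type*} [TopologicalSpace X] {f g : X → Plane} (hf : Continuous f)
    (hg : Continuous g) : Continuous fun x => cross (f x) (g x) := by
  unfold cross
  fun_prop

/-- A vector is controlled by its areas with two independent vectors. -/
theorem abs_cross_mul_norm_le (e b q : Plane) :
    |cross e b| * ‖q‖ ≤ |cross b q| * ‖e‖ + |cross e q| * ‖b‖ := by
  have h := cross_smul_add_cross_smul_add_cross_smul e b q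
  have h1 : cross e b • q = cross e q • b - cross b q • e := by
    rw [cross_swap e q] at h
    rw [← sub_eq_zero, ← h, neg_smul]
    abel
  calc |cross e b| * ‖q‖ = ‖cross e b • q‖ := by rw [norm_smul, Real.norm_eq_abs]
    _ ≤ ‖cross e q • b‖ + ‖cross b q • e‖ := by rw [h1]; exact norm_sub_le _ _
    _ = _ := by rw [norm_smul, norm_smul, Real.norm_eq_abs, Real.norm_eq_abs, add_comm]

theorem eq_zero_of_cross_eq_zero {e b q : Plane} (h : cross e b ≠ 0) (he : cross e q = 0)
    (hb : cross b q = 0) : q = 0 := by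
  have h1 := abs_cross_mul_norm_le e b q
  rw [he, hb, abs_zero, zero_mul, zero_mul, add_zero] at h1
  have h2 : 0 < |cross e b| := abs_pos.2 h
  exact norm_le_zero_iff.1 (nonpos_of_mul_nonpos_right h1 h2)

theorem exists_cross_ne_zero_of_not_collinear {V : Set Plane} (h : ¬ Collinear ℝ V) :
    ∃ p ∈ V, ∃ q ∈ V, ∃ r ∈ V, cross (q - p) (r - p) ≠ 0 := by
  by_contra! hc
  apply h
  rcases V.eq_empty_or_nonempty with rfl | ⟨p, hp⟩
  · exact collinear_empty ℝ Plane
  by_cases hV : ∃ q ∈ V, q ≠ p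
  · obtain ⟨q, hq, hqp⟩ := hV
    rw [collinear_iff_of_mem hp]
    refine ⟨q - p, fun r hr => ?_⟩
    have h0 := hc p hp q hq r hr
    have hne : ‖q - p‖ ^ 2 ≠ 0 := by
      have := norm_pos_iff.2 (sub_ne_zero.2 hqp)
      positivity
    -- the coefficient of the orthogonal projection of `r - p` to the line through `q - p`
    refine ⟨((q - p) 0 * (r - p) 0 + (q - p) 1 * (r - p) 1) / ‖q - p‖ ^ 2, ?_⟩
    rw [vadd_eq_add, ← sub_eq_iff_eq_add]
    have hn : ‖q - p‖ ^ 2 = (q - p) 0 ^ 2 + (q - p) 1 ^ 2 := by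
      rw [EuclideanSpace.norm_sq_eq, Fin.sum_univ_two, Real.norm_eq_abs, Real.norm_eq_abs,
        sq_abs, sq_abs]
    generalize q - p = a at *
    generalize r - p = b at *
    rw [div_eq_inv_mul, mul_smul, eq_comm, inv_smul_eq_iff₀ hne, hn]
    unfold cross at h0
    ext i
    fin_cases i
    · simp
      linear_combination (a 1) * h0
    · simp
      linear_combination (-a 0) * h0
  · push Not at hV
    exact (collinear_singleton ℝ p).subset hV

theorem _root_.Collinear.cross_eq_zero {V : Set Plane} (h : Collinear ℝ V) {p q r : Plane}
    (hp : p ∈ V) (hq : q ∈ V) (hr : r ∈ V) : cross (q - p) (r - p) = 0 := by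
  rw [collinear_iff_of_mem hp] at h
  obtain ⟨v, hv⟩ := h
  obtain ⟨s, rfl⟩ := hv q hq
  obtain ⟨t, rfl⟩ := hv r hr
  simp only [vadd_eq_add, add_sub_cancel_right, cross_smul_left, cross_smul_right, cross_self,
    mul_zero]

/-- An affine inequality that holds at the points of `V` holds on their convex hull. -/
theorem le_add_cross_of_mem_convexHull {V : Set Plane} {a : Plane} {b : ℝ}
    (h : ∀ z ∈ V, 0 ≤ b + cross a z) {p : Plane} (hp : p ∈ convexHull ℝ V) :
    0 ≤ b + cross a p := by
  have hconv : Convex ℝ {z : Plane | 0 ≤ b + cross a z} := by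
    intro y hy z hz s t hs ht hst
    have e : b + cross a (s • y + t • z) = s * (b + cross a y) + t * (b + cross a z) := by
      rw [cross_add_right, cross_smul_right, cross_smul_right]
      linear_combination (-b) * hst
    simp only [mem_ofPred_eq] at hy hz ⊢
    rw [e]
    positivity
  exact convexHull_min h hconv hp

/-! ### Discreteness of the vertex set -/

/-- The oriented areas spanned by differences of points of `V` are integer multiples of `δ`. For
a finite set that affinely spans the plane this says that `V` lies in a translate of a lattice. -/
def AreaDiscrete (V : Set Plane) (δ : ℝ) : Prop :=
  ∀ p ∈ V, ∀ q ∈ V, ∀ r ∈ V, ∀ s ∈ V, ∃ k : ℤ, cross (p - q) (r - s) = k * δ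

/-- Twice every product of two nonzero areas spanned by differences of points of `V` divides `K`
times any such area. -/
def IsCommonMultiple (V : Set Plane) (K : ℝ) : Prop :=
  ∀ p₁ ∈ V, ∀ q₁ ∈ V, ∀ p₂ ∈ V, ∀ q₂ ∈ V, ∀ p₃ ∈ V, ∀ q₃ ∈ V, ∀ p₄ ∈ V, ∀ q₄ ∈ V,
    ∀ p₅ ∈ V, ∀ q₅ ∈ V, ∀ p₆ ∈ V, ∀ q₆ ∈ V,
    cross (p₁ - q₁) (p₂ - q₂) ≠ 0 → cross (p₃ - q₃) (p₄ - q₄) ≠ 0 →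
    ∃ k : ℤ, K * cross (p₅ - q₅) (p₆ - q₆) =
      2 * k * cross (p₁ - q₁) (p₂ - q₂) * cross (p₃ - q₃) (p₄ - q₄)

theorem exists_norm_le_of_finite {V : Set Plane} (hV : V.Finite) :
    ∃ B : ℝ, 1 ≤ B ∧ (∀ p ∈ V, ‖p‖ ≤ B) ∧ (∀ p ∈ V, ∀ q ∈ V, ‖p - q‖ ≤ B) ∧
      ∀ p ∈ V, ∀ q ∈ V, ∀ r ∈ V, ∀ s ∈ V, |cross (p - q) (r - s)| ≤ B := by
  obtain ⟨D, hD⟩ := hV.isBounded.exists_norm_le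
  have hd : ∀ p ∈ V, ∀ q ∈ V, ‖p - q‖ ≤ 2 * |D| := fun p hp q hq => by
    have h1 := norm_sub_le p q
    have h2 := hD p hp
    have h3 := hD q hq
    have h4 := le_abs_self D
    linarith
  refine ⟨1 + 2 * |D| + (2 * |D|) * (2 * |D|), ?_, fun p hp => ?_, fun p hp q hq => ?_,
    fun p hp q hq r hr s hs => ?_⟩
  · have := abs_nonneg D
    nlinarith
  · have h1 := hD p hp
    have h2 := le_abs_self D
    have h3 := abs_nonneg D
    nlinarith
  · have h1 := hd p hp q hq
    have h3 := abs_nonneg D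
    nlinarith
  · have h1 := abs_cross_le (p - q) (r - s)
    have h2 := mul_le_mul (hd p hp q hq) (hd r hr s hs) (norm_nonneg _) (by positivity)
    have h3 := abs_nonneg D
    linarith

theorem AreaDiscrete.exists_isCommonMultiple {V : Set Plane} {δ : ℝ} (h : AreaDiscrete V δ)
    (hδ : 0 < δ) (hV : V.Finite) (M : ℝ) : ∃ K : ℝ, M ≤ K ∧ IsCommonMultiple V K := by
  obtain ⟨B, -, -, -, hB⟩ := exists_norm_le_of_finite hV
  obtain ⟨m, hm⟩ := exists_nat_ge (B / δ)
  -- all areas are `k * δ` with `|k| ≤ m`, and such a `k ≠ 0` divides `m!`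
  have hdvd : ∀ k : ℤ, |k * δ| ≤ B → (k : ℝ) * δ ≠ 0 → ∃ l : ℤ, (m.factorial : ℝ) = k * l := by
    intro k hk hk0
    have hk0' : k ≠ 0 := by
      rintro rfl
      simp at hk0
    have h1 : (k.natAbs : ℝ) ≤ m := by
      rw [abs_mul, abs_of_pos hδ, ← le_div_iff₀ hδ] at hk
      rw [Nat.cast_natAbs, Int.cast_abs]
      exact hk.trans hm
    have h2 : k.natAbs ∣ m.factorial :=
      Nat.dvd_factorial (Int.natAbs_pos.2 hk0') (by exact_mod_cast h1)
    have h3 : k ∣ (m.factorial : ℤ) := Int.natAbs_dvd.1 (Int.natCast_dvd_natCast.2 h2)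
    obtain ⟨l, hl⟩ := h3
    exact ⟨l, by exact_mod_cast hl⟩
  have hf : (0 : ℝ) < m.factorial := by exact_mod_cast m.factorial_pos
  obtain ⟨N, hN⟩ := exists_nat_ge (M / (2 * m.factorial ^ 2 * δ))
  refine ⟨2 * m.factorial ^ 2 * δ * (N + 1), ?_, ?_⟩
  · rw [div_le_iff₀ (by positivity)] at hN
    have : 0 < 2 * (m.factorial : ℝ) ^ 2 * δ := by positivity
    linarith
  · intro p₁ hp₁ q₁ hq₁ p₂ hp₂ q₂ hq₂ p₃ hp₃ q₃ hq₃ p₄ hp₄ q₄ hq₄ p₅ hp₅ q₅ hq₅ p₆ hp₆ q₆ hq₆ h1 h2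
    have hb1 := hB p₁ hp₁ q₁ hq₁ p₂ hp₂ q₂ hq₂
    have hb2 := hB p₃ hp₃ q₃ hq₃ p₄ hp₄ q₄ hq₄
    obtain ⟨k₁, e₁⟩ := h p₁ hp₁ q₁ hq₁ p₂ hp₂ q₂ hq₂
    obtain ⟨k₂, e₂⟩ := h p₃ hp₃ q₃ hq₃ p₄ hp₄ q₄ hq₄
    obtain ⟨k₃, e₃⟩ := h p₅ hp₅ q₅ hq₅ p₆ hp₆ q₆ hq₆
    rw [e₁] at h1 hb1 ⊢
    rw [e₂] at h2 hb2 ⊢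
    rw [e₃]
    obtain ⟨l₁, f₁⟩ := hdvd k₁ hb1 h1
    obtain ⟨l₂, f₂⟩ := hdvd k₂ hb2 h2
    refine ⟨l₁ * l₂ * k₃ * (N + 1), ?_⟩
    push_cast
    rw [sq]
    nth_rewrite 1 [f₁]
    rw [f₂]
    ring

/-! ### The tangents at a point and at its image -/

theorem IsRightTangentPoint.cross_nonneg {V : Set Plane} {x v : Plane}
    (h : IsRightTangentPoint V x v) {w : Plane} (hw : w ∈ V) : 0 ≤ cross (v - x) (w - v) := by
  rcases eq_or_ne w v with rfl | hne
  · simp [cross_zero_right]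
  · have h1 := h.2 w hw hne
    have h2 : w - x = (w - v) + (v - x) := by abel
    rw [h2, cross_add_right, cross_self, add_zero] at h1
    exact h1.le

theorem IsRightTangentPoint.cross_pos {V : Set Plane} {x v : Plane}
    (h : IsRightTangentPoint V x v) {w : Plane} (hw : w ∈ V) (hne : w ≠ v) :
    0 < cross (v - x) (w - v) := by
  have h1 := h.2 w hw hne
  have h2 : w - x = (w - v) + (v - x) := by abel
  rwa [h2, cross_add_right, cross_self, add_zero] at h1

/-- `v` is the vertex at which the left tangent from `y` touches the polygon; this is the tangent
along which `y` is reached by the outer billiard map. -/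
def IsLeftTangentPoint (V : Set Plane) (y v : Plane) : Prop :=
  v ∈ V ∧ ∀ w ∈ V, w ≠ v → 0 < cross (y - v) (w - v)

theorem IsRightTangentPoint.isLeftTangentPoint {V : Set Plane} {x v : Plane}
    (h : IsRightTangentPoint V x v) : IsLeftTangentPoint V ((2 : ℝ) • v - x) v := by
  refine ⟨h.1, fun w hw hne => ?_⟩
  have h1 := h.cross_pos hw hne
  have h2 : (2 : ℝ) • v - x - v = v - x := by module
  rwa [h2]

theorem IsLeftTangentPoint.cross_nonneg {V : Set Plane} {y v : Plane}
    (h : IsLeftTangentPoint V y v) {w : Plane} (hw : w ∈ V) : 0 ≤ cross (y - v) (w - v) := by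
  rcases eq_or_ne w v with rfl | hne
  · simp [cross_zero_right]
  · exact (h.2 w hw hne).le

theorem IsLeftTangentPoint.unique {V : Set Plane} {y v w : Plane}
    (hv : IsLeftTangentPoint V y v) (hw : IsLeftTangentPoint V y w) : v = w := by
  by_contra h
  have h1 := hv.2 w hw.1 (Ne.symm h)
  have h2 := hw.2 v hv.1 h
  unfold cross at h1 h2
  simp only [PiLp.sub_apply] at h1 h2
  linarith

/-- If `v` is the tangent point of `x` and `w` that of its image, then `w - v` is, up to a bounded
error, the difference of vertices that spans the largest area with `x - v`. -/
theorem cross_sub_le_of_tangent {V : Set Plane} {B : ℝ}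
    (hB : ∀ p ∈ V, ∀ q ∈ V, ∀ r ∈ V, ∀ s ∈ V, |cross (p - q) (r - s)| ≤ B)
    {x v w : Plane} (hv : IsRightTangentPoint V x v)
    (hw : IsRightTangentPoint V ((2 : ℝ) • v - x) w) {p q : Plane} (hp : p ∈ V) (hq : q ∈ V) :
    cross (p - q) (x - v) ≤ cross (w - v) (x - v) + B := by
  have h1 := hv.cross_nonneg hq
  have h2 := hw.cross_nonneg hp
  have h3 := (abs_le.1 (hB w hw.1 v hv.1 p hp w hw.1)).2
  simp only [cross, PiLp.sub_apply, PiLp.smul_apply, smul_eq_mul] at h1 h2 h3 ⊢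
  linarith

/-- The quantity `cross (w - v) (x - v)` measures the distance of `x` from the polygon. -/
theorem exists_norm_le_of_cross_le {V : Set Plane} (hV : IsConvexPolygon V) (M : ℝ) :
    ∃ R : ℝ, ∀ x v w : Plane, IsRightTangentPoint V x v →
      IsRightTangentPoint V ((2 : ℝ) • v - x) w → cross (w - v) (x - v) ≤ M → ‖x‖ ≤ R := by
  obtain ⟨B, hB1, hBn, hBd, hB⟩ := exists_norm_le_of_finite hV.finite
  obtain ⟨p, hp, q, hq, r, hr, h0⟩ := exists_cross_ne_zero_of_not_collinear hV.not_collinear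
  refine ⟨2 * B * (M + B) / |cross (q - p) (r - p)| + B, fun x v w hv hw hM => ?_⟩
  have hpos : 0 < |cross (q - p) (r - p)| := abs_pos.2 h0
  have key : ∀ a ∈ V, ∀ b ∈ V, |cross (a - b) (x - v)| ≤ M + B := by
    intro a ha b hb
    have h1 := cross_sub_le_of_tangent hB hv hw ha hb
    have h2 := cross_sub_le_of_tangent hB hv hw hb ha
    rw [← neg_sub a b, cross_neg_left] at h2
    rw [abs_le]
    constructor <;> linarith
  have h1 := abs_cross_mul_norm_le (q - p) (r - p) (x - v)
  have h2 := mul_le_mul (key r hr p hp) (hBd q hq p hp) (norm_nonneg _)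
    ((abs_nonneg _).trans (key r hr p hp))
  have h3 := mul_le_mul (key q hq p hp) (hBd r hr p hp) (norm_nonneg _)
    ((abs_nonneg _).trans (key r hr p hp))
  have h4 : ‖x - v‖ ≤ 2 * B * (M + B) / |cross (q - p) (r - p)| := by
    rw [le_div_iff₀ hpos]
    linarith
  have h5 := norm_le_norm_add_norm_sub' x v
  have h6 := hBn v hv.1
  linarith

/-! ### Points far from the polygon -/

theorem AreaDiscrete.le_of_pos {V : Set Plane} {δ : ℝ} (h : AreaDiscrete V δ) (hδ : 0 < δ)
    {p q r s : Plane} (hp : p ∈ V) (hq : q ∈ V) (hr : r ∈ V) (hs : s ∈ V)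
    (h0 : 0 < cross (p - q) (r - s)) : δ ≤ cross (p - q) (r - s) := by
  obtain ⟨k, hk⟩ := h p hp q hq r hr s hs
  rw [hk] at h0 ⊢
  have h1 : (0 : ℝ) < k := pos_of_mul_pos_left h0 hδ.le
  have h2 : (1 : ℝ) ≤ k := by exact_mod_cast (show (0 : ℤ) < k by exact_mod_cast h1)
  nlinarith

/-- If `e` lies in the open half-planes to the left of `c` and to the right of `b`, then a vector
whose area with `e` is bounded can lie in both closed half-planes to the right of `b` and of `c`
only if it is short. -/
theorem norm_le_of_cross_bounds {δ B : ℝ} (hδ : 0 < δ) {e b c q : Plane}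
    (heb : δ ≤ cross e b) (hce : δ ≤ cross c e) (hqb : 0 ≤ cross q b) (hqc : 0 ≤ cross q c)
    (hqe : |cross q e| ≤ 2 * B) (hbc : |cross b c| ≤ B) (he : ‖e‖ ≤ B) (hb : ‖b‖ ≤ B) :
    ‖q‖ ≤ (2 * B * B / δ + 2 * B) * B / δ := by
  have hB : 0 ≤ B := (norm_nonneg _).trans he
  have key : cross q b * cross c e + cross q c * cross e b = -(cross q e * cross b c) := by
    simp only [cross]; ring
  have h1 : |cross q e * cross b c| ≤ 2 * B * B := by
    rw [abs_mul]
    exact mul_le_mul hqe hbc (abs_nonneg _) (by positivity)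
  have h2 : cross q b * δ ≤ 2 * B * B := by
    have h3 := mul_le_mul_of_nonneg_left hce hqb
    have h4 : 0 ≤ cross q c * cross e b := mul_nonneg hqc (hδ.le.trans heb)
    have h5 := (abs_le.1 h1).1
    linarith
  have h3 : |cross b q| ≤ 2 * B * B / δ := by
    rw [cross_swap, abs_neg, abs_of_nonneg hqb, le_div_iff₀ hδ]
    exact h2
  have h4 : |cross e q| ≤ 2 * B := by rwa [cross_swap, abs_neg]
  have h5 := abs_cross_mul_norm_le e b q
  have h6 := mul_le_mul h3 he (norm_nonneg _) (by positivity)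
  have h7 := mul_le_mul h4 hb (norm_nonneg _) (by positivity)
  rw [le_div_iff₀ hδ]
  have h8 : δ * ‖q‖ ≤ |cross e b| * ‖q‖ :=
    mul_le_mul_of_nonneg_right (heb.trans (le_abs_self _)) (norm_nonneg _)
  linarith

/-- The point `y` has left tangent point `v` and right tangent point `w`, and `v'` is the right
tangent point of its image `2 • w - y`. If `v ≠ v'`, then `y` lies strictly between the line
through `v` and `v'` and the reflection of this line in `w`. -/
theorem cross_bounds_of_ne {V : Set Plane} {y v w v' : Plane} (hv : IsLeftTangentPoint V y v)
    (hv' : IsRightTangentPoint V ((2 : ℝ) • w - y) v') (hne : v ≠ v') :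
    cross (v' - v) (y - v) < 0 ∧ -(2 * cross (v' - v) (v - w)) < cross (v' - v) (y - v) := by
  have h1 := hv.2 v' hv'.1 hne.symm
  have h2 := hv'.cross_pos hv.1 hne
  simp only [cross, PiLp.sub_apply, PiLp.smul_apply, smul_eq_mul] at h1 h2 ⊢
  constructor <;> linarith

/-- In the situation of `cross_bounds_of_ne`, if `y` is far away, then the segment from `v` to `v'`
lies in a side of the polygon, and `w` is a vertex at maximal distance from this side. -/
theorem AreaDiscrete.exists_forall_side {V : Set Plane} {δ : ℝ} (h : AreaDiscrete V δ)
    (hδ : 0 < δ) (hV : V.Finite) :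
    ∃ R : ℝ, ∀ y v w v' : Plane, IsLeftTangentPoint V y v → IsRightTangentPoint V y w →
      IsRightTangentPoint V ((2 : ℝ) • w - y) v' → v ≠ v' → R < ‖y - w‖ →
      ∀ z ∈ V, cross (v' - v) (z - v) ≤ 0 ∧ 0 ≤ cross (v' - v) (z - w) := by
  obtain ⟨B, hB1, hBn, hBd, hB⟩ := exists_norm_le_of_finite hV
  refine ⟨(2 * B * B / δ + 2 * B) * B / δ + B, fun y v w v' hv hw hv' hne hfar z hz => ?_⟩
  obtain ⟨h1, h2⟩ := cross_bounds_of_ne hv hv' hne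
  have hpos : 0 < cross (v' - v) (v - w) := by linarith
  have hge := h.le_of_pos hδ hv'.1 hv.1 hv.1 hw.1 hpos
  have hle := (abs_le.1 (hB v' hv'.1 v hv.1 v hv.1 w hw.1)).2
  constructor
  · by_contra! hc
    have hgc := h.le_of_pos hδ hv'.1 hv.1 hz hv.1 hc
    have h3 := norm_le_of_cross_bounds (B := B) (e := v - v') (b := w - v) (c := z - v)
      (q := y - v) hδ ?_ ?_ (hv.cross_nonneg hw.1) (hv.cross_nonneg hz) ?_
      (hB w hw.1 v hv.1 z hz v hv.1) (hBd v hv.1 v' hv'.1) (hBd w hw.1 v hv.1)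
    · have h4 : y - w = (y - v) + (v - w) := by abel
      have h5 := norm_add_le (y - v) (v - w)
      rw [← h4] at h5
      have h6 := hBd v hv.1 w hw.1
      linarith
    · simp only [cross, PiLp.sub_apply] at hge ⊢
      linarith
    · simp only [cross, PiLp.sub_apply] at hgc ⊢
      linarith
    · have e1 : cross (y - v) (v - v') = cross (v' - v) (y - v) := by
        simp only [cross, PiLp.sub_apply]; ring
      rw [e1, abs_le]
      constructor <;> linarith
  · by_contra! hc
    have hgc := h.le_of_pos hδ hv'.1 hv.1 hw.1 hz (by
      rw [← neg_sub z w, cross_neg_right]; linarith)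
    have h3 := norm_le_of_cross_bounds (B := B) (e := v' - v) (b := v - w) (c := z - w)
      (q := w - y) hδ hge ?_ (hw.cross_nonneg hv.1) (hw.cross_nonneg hz) ?_
      (hB v hv.1 w hw.1 z hz w hw.1) (hBd v' hv'.1 v hv.1) (hBd v hv.1 w hw.1)
    · rw [norm_sub_rev] at h3
      linarith
    · simp only [cross, PiLp.sub_apply] at hgc ⊢
      linarith
    · have e1 : cross (w - y) (v' - v) = cross (v' - v) (y - v) + cross (v' - v) (v - w) := by
        simp only [cross, PiLp.sub_apply]; ring
      rw [e1, abs_le]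
      constructor <;> linarith

/-! ### Necklaces of copies of the polygon -/

/-- The translation vectors of the beads of the necklace of size `K` that border on the part of the
plane where the square of the outer billiard map is the translation by `2 • d`. Such a vector lies
on the line `cross d u = K`, and its area with every difference `p - q` of vertices not parallel to
`d` is an even multiple of the area of `p - q` and `d`. When `p - q` spans a side and `d` joins
this side to a farthest vertex, the second condition says that `u` shifts the polygon,
transversally to the side, by a multiple of twice its width. -/
def IsBeadShift (V : Set Plane) (K : ℝ) (d u : Plane) : Prop :=
  cross d u = K ∧ ∀ p ∈ V, ∀ q ∈ V, cross (p - q) d ≠ 0 →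
    ∃ k : ℤ, cross (p - q) u = 2 * k * cross (p - q) d

/-- For `v` a tangent point of `x` and `w` the tangent point of the image (or preimage) of `x`: the
point `x` is inside the necklace of size `K` or in one of its beads. A bead is a translate of the
polygon or of its reflection in `v`. -/
def Confined (V : Set Plane) (K : ℝ) (x v w : Plane) : Prop :=
  cross (w - v) (x - v) ≤ K ∨ ∃ u, IsBeadShift V K (w - v) u ∧
    (x - u ∈ convexHull ℝ V ∨ (2 : ℝ) • v + u - x ∈ convexHull ℝ V)

theorem IsBeadShift.neg {V : Set Plane} {K : ℝ} {d u : Plane} (h : IsBeadShift V K d u) :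
    IsBeadShift V K (-d) (-u) := by
  refine ⟨by rw [cross_neg_left, cross_neg_right, neg_neg, h.1], fun p hp q hq h0 => ?_⟩
  rw [cross_neg_right] at h0
  obtain ⟨k, hk⟩ := h.2 p hp q hq (by simpa using h0)
  exact ⟨k, by rw [cross_neg_right, cross_neg_right, hk]; ring⟩

theorem IsBeadShift.add_two_smul {V : Set Plane} {K : ℝ} {d u : Plane} (h : IsBeadShift V K d u) :
    IsBeadShift V K d (u + (2 : ℝ) • d) := by
  refine ⟨by rw [cross_add_right, cross_smul_right, cross_self, h.1]; ring,
    fun p hp q hq h0 => ?_⟩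
  obtain ⟨k, hk⟩ := h.2 p hp q hq h0
  refine ⟨k + 1, ?_⟩
  rw [cross_add_right, cross_smul_right, hk]
  push_cast
  ring

/-- The outer billiard map permutes the beads as long as the tangent points do not change. -/
theorem Confined.map {V : Set Plane} {K : ℝ} {x v w : Plane} (h : Confined V K x v w) :
    Confined V K ((2 : ℝ) • v - x) w v := by
  rcases h with h | ⟨u, hu, h | h⟩
  · left
    simp only [cross, PiLp.sub_apply, PiLp.smul_apply, smul_eq_mul] at h ⊢
    linarith
  · right
    refine ⟨-(u + (2 : ℝ) • (w - v)), ?_, Or.inr ?_⟩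
    · have h1 := hu.neg.add_two_smul
      rw [neg_sub] at h1
      convert h1 using 1
      module
    · convert h using 1
      module
  · right
    refine ⟨-u, ?_, Or.inl ?_⟩
    · have h1 := hu.neg
      rwa [neg_sub] at h1
    · convert h using 1
      module

/-- A vector on the line `cross d u = K` that is parallel to some difference `v' - v` of vertices is
admissible for `d`, provided that `d` itself is not parallel to `v' - v`. -/
theorem IsCommonMultiple.isBeadShift {V : Set Plane} {K : ℝ} (hK : IsCommonMultiple V K)
    {v v' w z u : Plane} (hv : v ∈ V) (hv' : v' ∈ V) (hw : w ∈ V) (hz : z ∈ V)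
    (h0 : cross (v' - v) (z - w) ≠ 0) (hu : cross (z - w) u = K) (he : cross (v' - v) u = 0) :
    IsBeadShift V K (z - w) u := by
  refine ⟨hu, fun p hp q hq hpq => ?_⟩
  obtain ⟨k, hk⟩ := hK v' hv' v hv z hz w hw p hp q hq z hz w hw p hp q hq v' hv' v hv h0 hpq
  refine ⟨-k, mul_left_cancel₀ h0 ?_⟩
  have key : cross (v' - v) (z - w) * cross (p - q) u =
      cross (v' - v) u * cross (p - q) (z - w) - cross (z - w) u * cross (p - q) (v' - v) := by
    simp only [cross]; ring
  rw [key, hu, he, hk]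
  push_cast
  ring

theorem abs_cross_sub_le_of_mem_convexHull {V : Set Plane} {B : ℝ}
    (hB : ∀ p ∈ V, ∀ q ∈ V, ∀ r ∈ V, ∀ s ∈ V, |cross (p - q) (r - s)| ≤ B) {v w z : Plane}
    (hv : v ∈ V) (hw : w ∈ V) (hz : z ∈ convexHull ℝ V) : |cross (w - v) (z - v)| ≤ B := by
  have h1 := le_add_cross_of_mem_convexHull (a := -(w - v)) (b := B + cross (w - v) v)
    (fun p hp => by
      have := (abs_le.1 (hB w hw v hv p hp v hv)).2
      rw [cross_sub_right] at this
      rw [cross_neg_left]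
      linarith) hz
  have h2 := le_add_cross_of_mem_convexHull (a := w - v) (b := B - cross (w - v) v)
    (fun p hp => by
      have := (abs_le.1 (hB w hw v hv p hp v hv)).1
      rw [cross_sub_right] at this
      linarith) hz
  rw [cross_neg_left] at h1
  rw [cross_sub_right, abs_le]
  constructor <;> linarith

theorem IsBeadShift.abs_cross_sub_le {V : Set Plane} {K B : ℝ}
    (hB : ∀ p ∈ V, ∀ q ∈ V, ∀ r ∈ V, ∀ s ∈ V, |cross (p - q) (r - s)| ≤ B) {x v w u : Plane}
    (hv : v ∈ V) (hw : w ∈ V) (hu : IsBeadShift V K (w - v) u)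
    (h : x - u ∈ convexHull ℝ V ∨ (2 : ℝ) • v + u - x ∈ convexHull ℝ V) :
    |cross (w - v) (x - v) - K| ≤ B := by
  rw [← hu.1]
  rcases h with h | h
  · have h1 := abs_cross_sub_le_of_mem_convexHull hB hv hw h
    rwa [sub_right_comm, cross_sub_right] at h1
  · have h1 := abs_cross_sub_le_of_mem_convexHull hB hv hw h
    have e : (2 : ℝ) • v + u - x - v = -((x - v) - u) := by module
    rwa [e, cross_neg_right, abs_neg, cross_sub_right] at h1

theorem Confined.cross_le {V : Set Plane} {K B : ℝ} (hB0 : 0 ≤ B)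
    (hB : ∀ p ∈ V, ∀ q ∈ V, ∀ r ∈ V, ∀ s ∈ V, |cross (p - q) (r - s)| ≤ B) {x v w : Plane}
    (hv : v ∈ V) (hw : w ∈ V) (h : Confined V K x v w) : cross (w - v) (x - v) ≤ K + B := by
  rcases h with h | ⟨u, hu, h⟩
  · linarith
  · have := (abs_le.1 (hu.abs_cross_sub_le hB hv hw h)).2
    linarith

/-- Between the line through `v` and `v'` and the reflection of this line in `w`, the only points
that are inside the necklace for the difference `v - w` but outside for `v' - w` belong to a bead:
they form a translate of the triangle with vertices `v`, `v'`, `w`. -/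
theorem sub_mem_convexHull_of_cross_le {V : Set Plane} {K : ℝ} {y v w v' : Plane} (hv : v ∈ V)
    (hv' : v' ∈ V) (hw : w ∈ V) (hpos : 0 < cross (v' - v) (v - w))
    (hy : cross (v' - v) (y - v) ≤ 0) (hin : cross (v - w) (y - w) ≤ K)
    (hout : K ≤ cross (v' - w) (y - w)) :
    y - (-(K / cross (v' - v) (v - w))) • (v' - v) ∈ convexHull ℝ V := by
  set c := cross (v' - v) (v - w) with hc
  set α := (cross (v' - w) (y - w) - K) / c with hα
  set β := (K - cross (v - w) (y - w)) / c with hβ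
  have hα0 : 0 ≤ α := div_nonneg (by linarith) hpos.le
  have hβ0 : 0 ≤ β := div_nonneg (by linarith) hpos.le
  have hsum : α + β ≤ 1 := by
    rw [hα, hβ, ← add_div, div_le_one hpos, hc]
    simp only [cross, PiLp.sub_apply] at hy ⊢
    linarith
  have e2 : y - (-(K / c)) • (v' - v) = α • v + β • v' + (1 - α - β) • w := by
    have e3 := cross_smul_add_cross_smul_add_cross_smul (v' - w) (v - w) (y - w)
    have e4 : cross (v' - w) (v - w) = c := by
      rw [hc]; simp only [cross, PiLp.sub_apply]; ring
    rw [e4, cross_swap (v' - w) (y - w)] at e3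
    have e6 : y = w + c⁻¹ • (cross (v' - w) (y - w) • (v - w) -
        cross (v - w) (y - w) • (v' - w)) := by
      rw [← sub_eq_iff_eq_add', eq_inv_smul_iff₀ hpos.ne', ← sub_eq_zero, ← e3]
      module
    rw [hα, hβ]
    generalize cross (v' - w) (y - w) = s at *
    generalize cross (v - w) (y - w) = t at *
    rw [e6]
    simp only [div_eq_mul_inv]
    module
  have h3 := (convex_convexHull ℝ V).sum_mem (t := Finset.univ) (w := ![α, β, 1 - α - β])
    (z := ![v, v', w])
    (by
      intro i _
      fin_cases i
      · exact hα0
      · exact hβ0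
      · show 0 ≤ 1 - α - β
        linarith)
    (by simp [Fin.sum_univ_three])
    (by
      intro i _
      fin_cases i
      · exact subset_convexHull ℝ V hv
      · exact subset_convexHull ℝ V hv'
      · exact subset_convexHull ℝ V hw)
  rw [e2]
  simpa [Fin.sum_univ_three] using h3

/-- For large `K`, a confined point stays confined when the tangent point `v` along which it was
reached is replaced by the next tangent point `v'`. -/
theorem IsCommonMultiple.confined_of_confined {V : Set Plane} {K R B : ℝ}
    (hK : IsCommonMultiple V K) (hBd : ∀ p ∈ V, ∀ q ∈ V, ‖p - q‖ ≤ B)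
    (hB : ∀ p ∈ V, ∀ q ∈ V, ∀ r ∈ V, ∀ s ∈ V, |cross (p - q) (r - s)| ≤ B)
    (hKR : B * R + B < K)
    (hR : ∀ y v w v' : Plane, IsLeftTangentPoint V y v → IsRightTangentPoint V y w →
      IsRightTangentPoint V ((2 : ℝ) • w - y) v' → v ≠ v' → R < ‖y - w‖ →
      ∀ z ∈ V, cross (v' - v) (z - v) ≤ 0 ∧ 0 ≤ cross (v' - v) (z - w))
    {y v w v' : Plane} (hv : IsLeftTangentPoint V y v) (hw : IsRightTangentPoint V y w)
    (hv' : IsRightTangentPoint V ((2 : ℝ) • w - y) v') (h : Confined V K y w v) :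
    Confined V K y w v' := by
  rcases eq_or_ne v v' with rfl | hne
  · exact h
  obtain ⟨h1, h2⟩ := cross_bounds_of_ne hv hv' hne
  have hpos : 0 < cross (v' - v) (v - w) := by linarith
  have hpos' : 0 < cross (v' - v) (v' - w) := by
    have : v' - w = (v' - v) + (v - w) := by abel
    rwa [this, cross_add_right, cross_self, zero_add]
  rcases h with h | ⟨u, hu, h⟩
  · by_cases hout : cross (v' - w) (y - w) ≤ K
    · exact Or.inl hout
    push Not at hout
    right
    refine ⟨(-(K / cross (v' - v) (v - w))) • (v' - v), ?_,
      Or.inl (sub_mem_convexHull_of_cross_le hv.1 hv'.1 hw.1 hpos h1.le h hout.le)⟩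
    refine hK.isBeadShift hv.1 hv'.1 hw.1 hv'.1 hpos'.ne' ?_ ?_
    · have e1 : cross (v' - w) (v' - v) = -cross (v' - v) (v - w) := by
        simp only [cross, PiLp.sub_apply]; ring
      rw [cross_smul_right, e1]
      field_simp
    · rw [cross_smul_right, cross_self, mul_zero]
  · right
    have hfar : R < ‖y - w‖ := by
      by_contra! hc
      have h3 := (abs_le.1 (hu.abs_cross_sub_le hB hw.1 hv.1 h)).1
      have h4 := (le_abs_self _).trans (abs_cross_le (v - w) (y - w))
      have h5 := mul_le_mul (hBd v hv.1 w hw.1) hc (norm_nonneg _)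
        ((norm_nonneg _).trans (hBd v hv.1 w hw.1))
      linarith
    have hside := hR y v w v' hv hw hv' hne hfar
    have hz1 : ∀ z ∈ convexHull ℝ V, cross (v' - v) (z - v) ≤ 0 := by
      intro z hz
      have := le_add_cross_of_mem_convexHull (a := -(v' - v)) (b := cross (v' - v) v)
        (fun p hp => by
          have := (hside p hp).1
          rw [cross_sub_right] at this
          rw [cross_neg_left]
          linarith) hz
      rw [cross_neg_left] at this
      rw [cross_sub_right]
      linarith
    have hz2 : ∀ z ∈ convexHull ℝ V, 0 ≤ cross (v' - v) (z - w) := by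
      intro z hz
      have := le_add_cross_of_mem_convexHull (a := v' - v) (b := -cross (v' - v) w)
        (fun p hp => by
          have := (hside p hp).2
          rw [cross_sub_right] at this
          linarith) hz
      rw [cross_sub_right]
      linarith
    -- the area `cross (v' - v) u` is a multiple of the width of the strip that contains `y`, and
    -- the bead meets this strip, so that the multiple is zero
    have hzero : cross (v' - v) u = 0 := by
      obtain ⟨k, hk⟩ := hu.2 v' hv'.1 v hv.1 hpos.ne'
      have hk1 : -(2 * cross (v' - v) (v - w)) < 2 * k * cross (v' - v) (v - w) ∧
          2 * k * cross (v' - v) (v - w) < 2 * cross (v' - v) (v - w) := by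
        rw [← hk]
        rcases h with h | h
        · have h3 := hz1 _ h
          have h4 := hz2 _ h
          simp only [cross, PiLp.sub_apply] at h1 h2 h3 h4 hpos ⊢
          constructor <;> linarith
        · have h3 := hz1 _ h
          have h4 := hz2 _ h
          simp only [cross, PiLp.sub_apply, PiLp.add_apply, PiLp.smul_apply, smul_eq_mul]
            at h1 h2 h3 h4 hpos ⊢
          constructor <;> linarith
      have h3 : (-1 : ℝ) < k := by
        by_contra! hc
        nlinarith
      have h4 : (k : ℝ) < 1 := by
        by_contra! hc
        nlinarith
      have h5 : k = 0 := by
        have h3' : (-1 : ℤ) < k := by exact_mod_cast h3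
        have h4' : k < (1 : ℤ) := by exact_mod_cast h4
        omega
      rw [hk, h5]
      simp
    refine ⟨u, hK.isBeadShift hv.1 hv'.1 hw.1 hv'.1 hpos'.ne' ?_ hzero, h⟩
    have e1 : v' - w = (v' - v) + (v - w) := by abel
    rw [e1, cross_add_left, hzero, zero_add, hu.1]

/-! ### Boundedness of orbits -/

/-- The sequence `x` is an infinite orbit, with tangent points `v`. -/
def IsOrbit (V : Set Plane) (x v : ℕ → Plane) : Prop :=
  ∀ n, IsRightTangentPoint V (x n) (v n) ∧ x (n + 1) = (2 : ℝ) • v n - x n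

/-- Every infinite orbit is bounded: it stays inside a sufficiently large necklace. -/
theorem IsOrbit.exists_norm_le {V : Set Plane} {δ : ℝ} (hV : IsConvexPolygon V) (hδ : 0 < δ)
    (h : AreaDiscrete V δ) {x v : ℕ → Plane} (hx : IsOrbit V x v) : ∃ R : ℝ, ∀ n, ‖x n‖ ≤ R := by
  obtain ⟨B, hB1, -, hBd, hB⟩ := exists_norm_le_of_finite hV.finite
  obtain ⟨R, hR⟩ := h.exists_forall_side hδ hV.finite
  -- `K` is so large that the necklace has no bead near the polygon and the orbit starts inside it
  obtain ⟨K, hK1, hK⟩ := h.exists_isCommonMultiple hδ hV.finite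
    (max (B * R + B + 1) (cross (v 1 - v 0) (x 0 - v 0)))
  have hKR : B * R + B < K := by
    have := (le_max_left _ _).trans hK1
    linarith
  have hconf : ∀ n, Confined V K (x n) (v n) (v (n + 1)) := by
    intro n
    induction n with
    | zero => exact Or.inl ((le_max_right _ _).trans hK1)
    | succ n ih =>
      have h0 := (hx (n + 1)).1
      have h1 := (hx (n + 2)).1
      rw [(hx (n + 1)).2] at h1
      have h2 := (hx n).1.isLeftTangentPoint
      have h3 := ih.map
      rw [← (hx n).2] at h2 h3
      exact hK.confined_of_confined hBd hB hKR hR h2 h0 h1 h3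
  obtain ⟨S, hS⟩ := exists_norm_le_of_cross_le hV (K + B)
  refine ⟨S, fun n => ?_⟩
  have h1 := (hx (n + 1)).1
  have h2 := (hconf n).cross_le (by linarith) hB (hx n).1.1 h1.1
  rw [(hx n).2] at h1
  exact hS _ _ _ (hx n).1 h1 h2

/-! ### Orbits of the outer billiard map -/

theorem IsRightTangentPoint.mem_exterior {V : Set Plane} {x v : Plane} (hV : V.Nontrivial)
    (h : IsRightTangentPoint V x v) : x ∈ exterior V := by
  intro hx
  have hconv : Convex ℝ {z : Plane | 0 < cross (v - x) (z - v) ∨ z = v} := by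
    intro y hy z hz s t hs ht hst
    have e : s • y + t • z - v = s • (y - v) + t • (z - v) := by
      obtain rfl : t = 1 - s := by linarith
      module
    have ec : cross (v - x) (s • y + t • z - v) =
        s * cross (v - x) (y - v) + t * cross (v - x) (z - v) := by
      rw [e, cross_add_right, cross_smul_right, cross_smul_right]
    have h0 : cross (v - x) (v - v) = 0 := by rw [sub_self, cross_zero_right]
    simp only [mem_ofPred_eq] at hy hz ⊢
    rw [ec]
    rcases hs.eq_or_lt with rfl | hs
    · rw [zero_add] at hst
      subst hst
      simpa using hz
    rcases ht.eq_or_lt with rfl | ht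
    · rw [add_zero] at hst
      subst hst
      simpa using hy
    rcases hy with hy | rfl <;> rcases hz with hz | rfl
    · left; positivity
    · left; rw [h0, mul_zero, add_zero]; positivity
    · left; rw [h0, mul_zero, zero_add]; positivity
    · right; rw [← add_smul, hst, one_smul]
  have hsub : V ⊆ {z : Plane | 0 < cross (v - x) (z - v) ∨ z = v} := by
    intro z hz
    by_cases hzv : z = v
    · exact Or.inr hzv
    · exact Or.inl (h.cross_pos hz hzv)
  rcases convexHull_min hsub hconv hx with h1 | rfl
  · rw [← neg_sub v x, cross_neg_right, cross_self] at h1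
    simp at h1
  · obtain ⟨w, hw, hne⟩ := hV.exists_ne x
    have := h.2 w hw hne
    rw [sub_self, cross_zero_left] at this
    exact this.false

theorem IsConvexPolygon.nontrivial {V : Set Plane} (hV : IsConvexPolygon V) : V.Nontrivial := by
  rw [← not_subsingleton_iff]
  intro h
  rcases h.eq_empty_or_singleton with h | ⟨p, h⟩
  · exact hV.not_collinear (h ▸ collinear_empty ℝ Plane)
  · exact hV.not_collinear (h ▸ collinear_singleton ℝ p)

theorem pointReflection_eq (v x : Plane) : Equiv.pointReflection v x = (2 : ℝ) • v - x := by
  rw [Equiv.pointReflection_apply, vsub_eq_sub, vadd_eq_add]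
  module

theorem IsRightTangentPoint.T_eq {V : Set Plane} {x v : Plane} (hV : V.Nontrivial)
    (h : IsRightTangentPoint V x v) : T V x = some ((2 : ℝ) • v - x) :=
  T_eq_some_iff.2 ⟨h.mem_exterior hV, v, h, (pointReflection_eq v x).symm⟩

theorem iterT_eq_some {V : Set Plane} (hV : V.Nontrivial) {x v : ℕ → Plane} {n : ℕ}
    (h : ∀ j < n, IsRightTangentPoint V (x j) (v j) ∧ x (j + 1) = (2 : ℝ) • v j - x j) :
    iterT V n (x 0) = some (x n) := by
  induction n with
  | zero => rfl
  | succ n ih =>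
    have h1 := h n n.lt_succ_self
    rw [iterT, ih fun j hj => h j (hj.trans n.lt_succ_self), Option.bind_some, h1.1.T_eq hV, h1.2]

theorem exists_isOrbit {V : Set Plane} {x : Plane} (hx : x ∈ exterior V)
    (hfin : x ∉ finitePoints V) : ∃ xs vs : ℕ → Plane, xs 0 = x ∧ IsOrbit V xs vs := by
  have h : ∀ n, ∃ y, iterT V n x = some y := fun n =>
    Option.ne_none_iff_exists'.1 fun h0 => hfin ⟨hx, n, h0⟩
  choose xs hxs using h
  have hstep : ∀ n, ∃ v, IsRightTangentPoint V (xs n) v ∧ xs (n + 1) = (2 : ℝ) • v - xs n := by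
    intro n
    have h1 := hxs (n + 1)
    rw [iterT, hxs n, Option.bind_some, T_eq_some_iff] at h1
    obtain ⟨-, v, hv, h2⟩ := h1
    exact ⟨v, hv, by rw [h2, pointReflection_eq]⟩
  choose vs hvs using hstep
  exact ⟨xs, vs, (Option.some.inj (hxs 0)).symm, hvs⟩

theorem iterT_add {V : Set Plane} (m n : ℕ) (x : Plane) :
    iterT V (m + n) x = (iterT V m x).bind (iterT V n) := by
  induction n with
  | zero => simp [iterT]
  | succ n ih =>
    rw [← add_assoc, iterT, ih, Option.bind_assoc]
    rfl

theorem notMem_finitePoints_of_iterT_eq {V : Set Plane} {x : Plane} {n : ℕ} (hn : 0 < n)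
    (h : iterT V n x = some x) : x ∉ finitePoints V := by
  rintro ⟨-, m, hm⟩
  have h1 : ∀ k, iterT V (n * k) x = some x := by
    intro k
    induction k with
    | zero => rfl
    | succ k ih => rw [Nat.mul_succ, iterT_add, ih, Option.bind_some, h]
  have h2 := h1 m
  rw [← Nat.add_sub_of_le (Nat.le_mul_of_pos_left m hn), iterT_add, hm] at h2
  simp at h2

theorem IsOrbit.eq_of_add_eq {V : Set Plane} {x v : ℕ → Plane} (hx : IsOrbit V x v) (k : ℕ)
    {a b : ℕ} (h : x (k + a) = x (k + b)) : x a = x b := by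
  induction k with
  | zero => simpa using h
  | succ k ih =>
    apply ih
    rw [add_right_comm, add_right_comm k 1 b] at h
    have ha := (hx (k + a)).1.isLeftTangentPoint
    have hb := (hx (k + b)).1.isLeftTangentPoint
    rw [← (hx (k + a)).2, h, (hx (k + b)).2] at ha
    have h1 := ha.unique hb
    rw [(hx (k + a)).2, (hx (k + b)).2, h1] at h
    exact sub_right_injective h

/-- Every infinite orbit is periodic: its points of even index lie in a translate of a lattice,
and they are bounded. -/
theorem IsOrbit.exists_period {V : Set Plane} {δ : ℝ} (hV : IsConvexPolygon V) (hδ : 0 < δ)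
    (h : AreaDiscrete V δ) {x v : ℕ → Plane} (hx : IsOrbit V x v) :
    ∃ n, 0 < n ∧ x (2 * n) = x 0 := by
  obtain ⟨R, hR⟩ := hx.exists_norm_le hV hδ h
  obtain ⟨p, hp, q, hq, r, hr, h0⟩ := exists_cross_ne_zero_of_not_collinear hV.not_collinear
  have hcoord : ∀ a ∈ V, ∀ b ∈ V, ∀ n, ∃ k : ℤ, cross (a - b) (x (2 * n) - x 0) = k * δ := by
    intro a ha b hb n
    induction n with
    | zero => exact ⟨0, by simp [cross_zero_right]⟩
    | succ n ih =>
      obtain ⟨k, hk⟩ := ih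
      obtain ⟨l, hl⟩ := h a ha b hb _ (hx (2 * n + 1)).1.1 _ (hx (2 * n)).1.1
      refine ⟨k + 2 * l, ?_⟩
      have e : x (2 * (n + 1)) - x 0 =
          (x (2 * n) - x 0) + (2 : ℝ) • (v (2 * n + 1) - v (2 * n)) := by
        rw [show 2 * (n + 1) = 2 * n + 1 + 1 by ring, (hx (2 * n + 1)).2, (hx (2 * n)).2]
        module
      rw [e, cross_add_right, cross_smul_right, hk, hl]
      push_cast
      ring
  have hbound : ∀ a b : Plane, ∀ n, ∀ k : ℤ, cross (a - b) (x (2 * n) - x 0) = k * δ →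
      k ∈ Icc (-⌈‖a - b‖ * (2 * R) / δ⌉) ⌈‖a - b‖ * (2 * R) / δ⌉ := by
    intro a b n k hk
    have h1 := abs_cross_le (a - b) (x (2 * n) - x 0)
    have h2 : ‖x (2 * n) - x 0‖ ≤ 2 * R := by
      have h3 := norm_sub_le (x (2 * n)) (x 0)
      have h4 := hR (2 * n)
      have h5 := hR 0
      linarith
    have h3 := mul_le_mul_of_nonneg_left h2 (norm_nonneg (a - b))
    rw [hk, abs_mul, abs_of_pos hδ] at h1
    have h4 : |(k : ℝ)| ≤ ‖a - b‖ * (2 * R) / δ := by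
      rw [le_div_iff₀ hδ]
      linarith
    have h5 := h4.trans (Int.le_ceil _)
    have h6 : |k| ≤ ⌈‖a - b‖ * (2 * R) / δ⌉ := by exact_mod_cast h5
    exact ⟨(abs_le.1 h6).1, (abs_le.1 h6).2⟩
  choose k hk using hcoord q hq p hp
  choose l hl using hcoord r hr p hp
  obtain ⟨m, -, n, -, hmn, heq⟩ := infinite_univ.exists_lt_map_eq_of_mapsTo
    (f := fun n => (k n, l n)) (fun n _ => mk_mem_prod (hbound _ _ n _ (hk n))
      (hbound _ _ n _ (hl n))) ((finite_Icc _ _).prod (finite_Icc _ _))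
  refine ⟨n - m, by omega, ?_⟩
  have hkk : k m = k n := congrArg Prod.fst heq
  have hll : l m = l n := congrArg Prod.snd heq
  have e1 : x (2 * n) - x (2 * m) = 0 := by
    have e2 : x (2 * n) - x (2 * m) = (x (2 * n) - x 0) - (x (2 * m) - x 0) := by abel
    apply eq_zero_of_cross_eq_zero h0
    · rw [e2, cross_sub_right, hk, hk, hkk, sub_self]
    · rw [e2, cross_sub_right, hl, hl, hll, sub_self]
  apply hx.eq_of_add_eq (2 * m)
  rw [show 2 * m + 2 * (n - m) = 2 * n by omega, add_zero]
  exact sub_eq_zero.1 e1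

/-! ### Bounded intersections of half-planes -/

section HalfPlanes

variable {ι : Type*} (a : ι → Plane) (b : ι → ℝ)

theorem add_cross_combo (i : ι) (y z : Plane) {s t : ℝ} (hst : s + t = 1) :
    b i + cross (a i) (s • y + t • z) =
      s * (b i + cross (a i) y) + t * (b i + cross (a i) z) := by
  rw [cross_add_right, cross_smul_right, cross_smul_right]
  linear_combination (-b i) * hst

theorem convex_halfPlanes : Convex ℝ {y | ∀ i, 0 < b i + cross (a i) y} := by
  intro y hy z hz s t hs ht hst i
  rw [add_cross_combo a b i y z hst]
  rcases hs.eq_or_lt with rfl | hs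
  · rw [zero_add] at hst
    subst hst
    simpa using hz i
  · exact add_pos_of_pos_of_nonneg (mul_pos hs (hy i)) (mul_nonneg ht (hz i).le)

theorem convex_closedHalfPlanes : Convex ℝ {y | ∀ i, 0 ≤ b i + cross (a i) y} := by
  intro y hy z hz s t hs ht hst i
  rw [add_cross_combo a b i y z hst]
  exact add_nonneg (mul_nonneg hs (hy i)) (mul_nonneg ht (hz i))

theorem isOpen_halfPlanes [Finite ι] : IsOpen {y | ∀ i, 0 < b i + cross (a i) y} := by
  rw [ofPred_forall]
  exact isOpen_iInter_of_finite fun i => isOpen_lt continuous_const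
    (continuous_const.add (continuous_cross continuous_const continuous_id))

theorem isClosed_closedHalfPlanes : IsClosed {y | ∀ i, 0 ≤ b i + cross (a i) y} := by
  rw [ofPred_forall]
  exact isClosed_iInter fun i => isClosed_le continuous_const
    (continuous_const.add (continuous_cross continuous_const continuous_id))

theorem closure_halfPlanes (hne : {y | ∀ i, 0 < b i + cross (a i) y}.Nonempty) :
    closure {y | ∀ i, 0 < b i + cross (a i) y} = {y | ∀ i, 0 ≤ b i + cross (a i) y} := by
  apply Subset.antisymm
  · exact closure_minimal (fun y hy i => (hy i).le) (isClosed_closedHalfPlanes a b)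
  · intro y hy
    obtain ⟨x, hx⟩ := hne
    have hlim : Tendsto (fun t : ℝ => (1 - t) • y + t • x) (𝓝[>] 0) (𝓝 y) := by
      have : Continuous fun t : ℝ => (1 - t) • y + t • x := by fun_prop
      have h1 := this.tendsto 0
      simp only [sub_zero, one_smul, zero_smul, add_zero] at h1
      exact h1.mono_left nhdsWithin_le_nhds
    refine mem_closure_of_tendsto hlim ?_
    filter_upwards [Ioo_mem_nhdsGT (zero_lt_one' ℝ)] with t ht i
    rw [add_cross_combo a b i y x (by ring)]
    exact add_pos_of_nonneg_of_pos (mul_nonneg (by linarith [ht.2]) (hy i)) (mul_pos ht.1 (hx i))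

/-- An extreme point is determined by the half-planes on whose boundary it lies. -/
theorem eq_of_mem_extremePoints [Finite ι] {p q : Plane}
    (hp : p ∈ {y | ∀ i, 0 ≤ b i + cross (a i) y}.extremePoints ℝ)
    (hq : ∀ i, 0 ≤ b i + cross (a i) q)
    (hpq : ∀ i, b i + cross (a i) p = 0 → b i + cross (a i) q = 0) : p = q := by
  have hev : ∀ᶠ ε : ℝ in 𝓝[>] 0, ∀ i, 0 ≤ b i + cross (a i) (p + ε • (p - q)) := by
    rw [eventually_all]
    intro i
    rcases (hp.1 i).eq_or_lt with h0 | hpos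
    · refine Eventually.of_forall fun ε => ?_
      have h1 := hpq i h0.symm
      rw [cross_add_right, cross_smul_right, cross_sub_right,
        show b i + (cross (a i) p + ε * (cross (a i) p - cross (a i) q)) = 0 by
          linear_combination (-1 - ε) * h0 - ε * h1]
    · have hc : Continuous fun ε : ℝ => b i + cross (a i) (p + ε • (p - q)) :=
        continuous_const.add (continuous_cross continuous_const (by fun_prop))
      have h1 := hc.tendsto 0
      simp only [zero_smul, add_zero] at h1
      filter_upwards [(h1.mono_left nhdsWithin_le_nhds).eventually (lt_mem_nhds hpos)] with ε hε
      exact hε.le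
  obtain ⟨ε, hε, hε0⟩ := (hev.and self_mem_nhdsWithin).exists
  have hε0 : 0 < ε := hε0
  have hseg : p ∈ openSegment ℝ (p + ε • (p - q)) q := by
    refine ⟨1 / (1 + ε), ε / (1 + ε), by positivity, by positivity, by field_simp, ?_⟩
    have hne : (1 + ε) ≠ 0 := by positivity
    have e1 : (1 / (1 + ε)) • (p + ε • (p - q)) + (ε / (1 + ε)) • q =
        ((1 + ε) * (1 / (1 + ε))) • p := by
      simp only [div_eq_mul_inv]
      module
    rw [e1, mul_one_div_cancel hne, one_smul]
  have h1 := hp.2 hε hq hseg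
  rw [add_eq_left, smul_eq_zero, sub_eq_zero] at h1
  exact h1.resolve_left hε0.ne'

theorem finite_extremePoints_closedHalfPlanes [Finite ι] :
    ({y | ∀ i, 0 ≤ b i + cross (a i) y}.extremePoints ℝ).Finite := by
  refine Set.Finite.of_finite_image (f := fun p => {i | b i + cross (a i) p = 0}) (toFinite _) ?_
  intro p hp q hq hpq
  refine eq_of_mem_extremePoints a b hp hq.1 fun i hi => ?_
  have : i ∈ {i | b i + cross (a i) q = 0} := by
    have h2 : {i | b i + cross (a i) p = 0} = {i | b i + cross (a i) q = 0} := hpq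
    rw [← h2]
    exact hi
  exact this

theorem not_collinear_of_isOpen {C : Set Plane} (hC : IsOpen C) (hne : C.Nonempty) :
    ¬ Collinear ℝ C := by
  intro hcol
  obtain ⟨x, hx⟩ := hne
  have key : ∀ e : Plane, ∀ᶠ t : ℝ in 𝓝[>] 0, x + t • e ∈ C := by
    intro e
    have hc : Continuous fun t : ℝ => x + t • e := by fun_prop
    have h1 := hc.tendsto 0
    simp only [zero_smul, add_zero] at h1
    exact (h1.mono_left nhdsWithin_le_nhds).eventually (hC.mem_nhds hx)
  obtain ⟨t, ⟨h0, h1⟩, ht⟩ :=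
    (((key !₂[1, 0]).and (key !₂[0, 1])).and self_mem_nhdsWithin).exists
  have h2 := hcol.cross_eq_zero hx h0 h1
  have ht : 0 < t := ht
  simp [cross] at h2
  exact ht.ne' h2

/-- A nonempty bounded intersection of finitely many open half-planes is an open convex polygon,
whose vertices are the extreme points of its closure. -/
theorem isOpenPolygon_halfPlanes [Finite ι]
    (hne : {y | ∀ i, 0 < b i + cross (a i) y}.Nonempty)
    (hbd : Bornology.IsBounded {y | ∀ i, 0 < b i + cross (a i) y}) :
    IsOpenPolygon {y | ∀ i, 0 < b i + cross (a i) y} := by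
  set C := {y | ∀ i, 0 < b i + cross (a i) y} with hC
  set D := {y | ∀ i, 0 ≤ b i + cross (a i) y} with hD
  have hcl : closure C = D := closure_halfPlanes a b hne
  have hopen : IsOpen C := isOpen_halfPlanes a b
  have hconv : Convex ℝ D := convex_closedHalfPlanes a b
  have hcomp : IsCompact D := by
    rw [← hcl]
    exact hbd.isCompact_closure
  have hfin : (D.extremePoints ℝ).Finite := finite_extremePoints_closedHalfPlanes a b
  have hhull : convexHull ℝ (D.extremePoints ℝ) = D := by
    have h1 := closure_convexHull_extremePoints hcomp hconv
    rwa [(hfin.isClosed_convexHull ℝ).closure_eq] at h1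
  have hsub : C ⊆ D := fun y hy i => (hy i).le
  refine ⟨D.extremePoints ℝ, ⟨hfin, hconv.convexIndependent_extremePoints, fun hcol => ?_⟩, ?_⟩
  · have h1 : Collinear ℝ D := by
      rw [Collinear, ← direction_affineSpan] at hcol ⊢
      rwa [← hhull, affineSpan_convexHull]
    exact not_collinear_of_isOpen hopen hne (h1.subset hsub)
  · rw [hhull, ← hcl, (convex_halfPlanes a b).interior_closure_eq_interior_of_nonempty_interior
      (by rwa [hopen.interior_eq]), hopen.interior_eq]

end HalfPlanes

/-! ### Cells of points with the same itinerary -/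

/-- The successive reflections of `y` in the points `v 0`, `v 1`, …. -/
def reflections (v : ℕ → Plane) (y : Plane) : ℕ → Plane
  | 0 => y
  | n + 1 => (2 : ℝ) • v n - reflections v y n

/-- The points whose first `N` tangent points are `v 0`, …, `v (N - 1)`. -/
def cell (V : Set Plane) (v : ℕ → Plane) (N : ℕ) : Set Plane :=
  {y | ∀ j < N, IsRightTangentPoint V (reflections v y j) (v j)}

theorem reflections_eq (v : ℕ → Plane) (y : Plane) (n : ℕ) :
    reflections v y n = reflections v 0 n + (-1 : ℝ) ^ n • y := by
  induction n with
  | zero => simp [reflections]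
  | succ n ih =>
    rw [reflections, reflections, ih, pow_succ]
    module

theorem continuous_reflections (v : ℕ → Plane) (n : ℕ) :
    Continuous fun y => reflections v y n := by
  rw [funext fun y => reflections_eq v y n]
  fun_prop

theorem IsOrbit.reflections_eq {V : Set Plane} {x v : ℕ → Plane} (hx : IsOrbit V x v) (n : ℕ) :
    reflections v (x 0) n = x n := by
  induction n with
  | zero => rfl
  | succ n ih => rw [reflections, ih, (hx n).2]

theorem iterT_of_mem_cell {V : Set Plane} (hV : V.Nontrivial) {v : ℕ → Plane} {N : ℕ} {y : Plane}
    (hy : y ∈ cell V v N) : iterT V N y = some (reflections v y N) :=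
  iterT_eq_some (x := reflections v y) hV fun j hj => ⟨hy j hj, rfl⟩

theorem mem_exterior_of_mem_cell {V : Set Plane} (hV : V.Nontrivial) {v : ℕ → Plane} {N : ℕ}
    (hN : 0 < N) {y : Plane} (hy : y ∈ cell V v N) : y ∈ exterior V :=
  IsRightTangentPoint.mem_exterior hV (hy 0 hN)

/-- A cell is a finite intersection of open half-planes. -/
theorem exists_cell_eq_halfPlanes {V : Set Plane} (hV : V.Finite) {v : ℕ → Plane} {N : ℕ}
    (hv : ∀ j < N, v j ∈ V) : ∃ (ι : Type) (_ : Finite ι) (a : ι → Plane) (b : ι → ℝ),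
      cell V v N = {y | ∀ i, 0 < b i + cross (a i) y} := by
  have := hV.to_subtype
  refine ⟨{p : Fin N × V // (p.2 : Plane) ≠ v p.1}, inferInstance,
    fun p => (-1 : ℝ) ^ (p.1.1 : ℕ) • ((p.1.2 : Plane) - v p.1.1),
    fun p => cross (v p.1.1) p.1.2 +
      cross ((p.1.2 : Plane) - v p.1.1) (reflections v 0 p.1.1), ?_⟩
  have key : ∀ (j : ℕ) (w y : Plane), cross (v j - reflections v y j) (w - reflections v y j) =
      cross (v j) w + cross (w - v j) (reflections v 0 j) +
        cross ((-1 : ℝ) ^ j • (w - v j)) y := by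
    intro j w y
    rw [OuterBilliard.reflections_eq v y j]
    simp only [cross, PiLp.sub_apply, PiLp.add_apply, PiLp.smul_apply, smul_eq_mul]
    ring
  ext y
  constructor
  · rintro hy ⟨⟨j, w⟩, hw⟩
    have h1 := (hy j j.2).2 w w.2 hw
    rwa [key] at h1
  · intro hy j hj
    refine ⟨hv j hj, fun w hw hne => ?_⟩
    rw [key]
    exact hy ⟨⟨⟨j, hj⟩, ⟨w, hw⟩⟩, hne⟩

/-- A point of the closure of a cell whose orbit is not finite belongs to the cell: a tangent point
can change only by way of a tangent along a side. -/
theorem mem_cell_of_mem_closure {V : Set Plane} {v : ℕ → Plane} {N : ℕ} (hv : ∀ j < N, v j ∈ V)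
    {y : Plane} (hy : y ∈ exterior V) (hfin : y ∉ finitePoints V)
    (hcl : y ∈ closure (cell V v N)) : y ∈ cell V v N := by
  have hle : ∀ j < N, ∀ w ∈ V,
      0 ≤ cross (v j - reflections v y j) (w - reflections v y j) := by
    intro j hj w hw
    have hclosed : IsClosed
        {y | 0 ≤ cross (v j - reflections v y j) (w - reflections v y j)} := by
      have hc := continuous_reflections v j
      exact isClosed_le continuous_const (continuous_cross (by fun_prop) (by fun_prop))
    refine closure_minimal (fun z hz => ?_) hclosed hcl
    by_cases hne : w = v j
    · rw [hne]
      exact (cross_self _).ge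
    · exact ((hz j hj).2 w hw hne).le
  obtain ⟨xs, vs, rfl, horb⟩ := exists_isOrbit hy hfin
  have hrefl : ∀ j ≤ N, reflections v (xs 0) j = xs j := by
    intro j
    induction j with
    | zero => exact fun _ => rfl
    | succ j ih =>
      intro hj
      have hj' := ih (by omega)
      have h1 : vs j = v j := by
        by_contra hne
        have h2 := (horb j).1.2 (v j) (hv j (by omega)) (Ne.symm hne)
        have h3 := hle j (by omega) (vs j) (horb j).1.1
        rw [hj', cross_swap] at h3
        linarith
      rw [reflections, hj', (horb j).2, h1]
  intro j hj
  have h1 := hrefl j hj.le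
  have h2 := hrefl (j + 1) hj
  rw [reflections, h1, (horb j).2, sub_left_inj] at h2
  have h3 := smul_right_injective Plane (two_ne_zero (α := ℝ)) h2
  rw [h1, h3]
  exact (horb j).1

/-- A cell of positive even length `2 * n` on which the `2 * n`-th iterate is the identity is
bounded: the iterate is a composition of `n` translations, and for a point `y` far away the
translation vectors all lie strictly on the same side of the line through `0` and `y`. -/
theorem isBounded_cell {V : Set Plane} (hV : IsConvexPolygon V) {v : ℕ → Plane} {n : ℕ}
    (hn : 0 < n) (hper : ∀ y, reflections v y (2 * n) = y) :
    Bornology.IsBounded (cell V v (2 * n)) := by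
  obtain ⟨B, hB1, hBn, hBd, -⟩ := exists_norm_le_of_finite hV.finite
  obtain ⟨S, hS⟩ : ∃ S : ℝ, ∀ j ≤ 2 * n, ‖reflections v 0 j‖ ≤ S := by
    obtain ⟨S, hS⟩ := ((finite_Iic (2 * n)).image fun j => ‖reflections v 0 j‖).bddAbove
    exact ⟨S, fun j hj => hS ⟨j, hj, rfl⟩⟩
  have hS0 : 0 ≤ S := (norm_nonneg _).trans (hS 0 (by omega))
  obtain ⟨R, hR⟩ := exists_norm_le_of_cross_le hV (B * (B + S))
  rw [isBounded_iff_forall_norm_le]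
  refine ⟨R + S, fun y hy => ?_⟩
  by_contra! hc
  have hpos : ∀ j < n, 0 < cross (v (2 * j + 1) - v (2 * j)) y := by
    intro j hj
    have h0 := hy (2 * j) (by omega)
    have h1 := hy (2 * j + 1) (by omega)
    have e : reflections v y (2 * j) = reflections v 0 (2 * j) + y := by
      rw [OuterBilliard.reflections_eq v y, pow_mul]
      simp
    have h2 : B * (B + S) < cross (v (2 * j + 1) - v (2 * j))
        (reflections v y (2 * j) - v (2 * j)) := by
      by_contra! h3
      have h4 := hR _ _ _ h0 h1 h3
      rw [e] at h4
      have h5 := norm_sub_le (reflections v 0 (2 * j) + y) (reflections v 0 (2 * j))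
      rw [add_sub_cancel_left] at h5
      have h6 := hS (2 * j) (by omega)
      linarith
    have h3 : |cross (v (2 * j + 1) - v (2 * j)) (reflections v 0 (2 * j) - v (2 * j))| ≤
        B * (B + S) := by
      refine (abs_cross_le _ _).trans
        (mul_le_mul (hBd _ h1.1 _ h0.1) ?_ (norm_nonneg _) (by linarith))
      refine (norm_sub_le _ _).trans ?_
      have := hS (2 * j) (by omega)
      have := hBn _ h0.1
      linarith
    have h4 := (abs_le.1 h3).2
    rw [e, add_sub_right_comm, cross_add_right] at h2
    linarith
  have hsum : ∀ m ≤ n, 0 ≤ cross (reflections v 0 (2 * m)) y ∧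
      (0 < m → 0 < cross (reflections v 0 (2 * m)) y) := by
    intro m
    induction m with
    | zero => exact fun _ => ⟨(cross_zero_left y).ge, fun h => absurd h (lt_irrefl 0)⟩
    | succ m ih =>
      intro hm
      have h1 := (ih (by omega)).1
      have h2 := hpos m (by omega)
      have e : reflections v 0 (2 * (m + 1)) =
          (2 : ℝ) • (v (2 * m + 1) - v (2 * m)) + reflections v 0 (2 * m) := by
        rw [show 2 * (m + 1) = 2 * m + 1 + 1 by ring, reflections, reflections]
        module
      have h3 : 0 < cross (reflections v 0 (2 * (m + 1))) y := by
        rw [e, cross_add_left, cross_smul_left]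
        linarith
      exact ⟨h3.le, fun _ => h3⟩
  have h1 := (hsum n le_rfl).2 hn
  rw [hper, cross_zero_left] at h1
  exact h1.false

/-- The assertions about orbits and components, for a polygon whose vertices lie in a lattice. -/
theorem AreaDiscrete.periodic {V : Set Plane} {δ : ℝ} (hV : IsConvexPolygon V) (hδ : 0 < δ)
    (h : AreaDiscrete V δ) :
    (∀ x ∈ exterior V, x ∉ finitePoints V → x ∈ periodicPoints V) ∧
      ∀ C : Set Plane, IsComponent V C → IsOpenPolygon C ∧ C ⊆ periodicPoints V ∧
        ∃ n : ℕ, 0 < n ∧ ∀ y ∈ C, iterT V n y = some y := by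
  have hnt := hV.nontrivial
  constructor
  · intro x hx hfin
    obtain ⟨xs, vs, rfl, horb⟩ := exists_isOrbit hx hfin
    obtain ⟨n, hn, hper⟩ := horb.exists_period hV hδ h
    refine ⟨hx, 2 * n, by omega, ?_⟩
    rw [iterT_eq_some hnt fun j _ => horb j, hper]
  · rintro C ⟨x, hx, rfl⟩
    obtain ⟨xs, vs, rfl, horb⟩ := exists_isOrbit hx.1 hx.2
    obtain ⟨n, hn, hper⟩ := horb.exists_period hV hδ h
    have hv : ∀ j < 2 * n, vs j ∈ V := fun j _ => (horb j).1.1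
    have hmem : xs 0 ∈ cell V vs (2 * n) := fun j _ => by
      rw [horb.reflections_eq]
      exact (horb j).1
    -- the composition of an even number of reflections is a translation, and it fixes `xs 0`
    have hid : ∀ y, reflections vs y (2 * n) = y := by
      intro y
      have h1 := horb.reflections_eq (2 * n)
      rw [OuterBilliard.reflections_eq vs, hper, pow_mul] at h1
      rw [OuterBilliard.reflections_eq vs, pow_mul]
      simp only [even_two, Even.neg_pow, one_pow, one_smul, add_eq_right] at h1 ⊢
      exact h1
    have hiter : ∀ y ∈ cell V vs (2 * n), iterT V (2 * n) y = some y := fun y hy => by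
      rw [iterT_of_mem_cell hnt hy, hid]
    have hext : ∀ y ∈ cell V vs (2 * n), y ∈ exterior V := fun y hy =>
      mem_exterior_of_mem_cell hnt (by omega) hy
    obtain ⟨ι, hι, a, b, hab⟩ := exists_cell_eq_halfPlanes hV.finite hv
    have hcell : connectedComponentIn (exterior V \ finitePoints V) (xs 0) =
        cell V vs (2 * n) := by
      apply Subset.antisymm
      · refine isPreconnected_connectedComponentIn.subset_of_closure_inter_subset ?_
          ⟨xs 0, mem_connectedComponentIn hx, hmem⟩ ?_
        · rw [hab]
          exact isOpen_halfPlanes a b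
        · rintro y ⟨hy1, hy2⟩
          have hy3 := connectedComponentIn_subset _ _ hy2
          exact mem_cell_of_mem_closure hv hy3.1 hy3.2 hy1
      · refine IsPreconnected.subset_connectedComponentIn ?_ hmem fun y hy =>
          ⟨hext y hy, notMem_finitePoints_of_iterT_eq (by omega) (hiter y hy)⟩
        rw [hab]
        exact (convex_halfPlanes a b).isPreconnected
    rw [hcell]
    refine ⟨?_, fun y hy => ⟨hext y hy, 2 * n, by omega, hiter y hy⟩, 2 * n, by omega, hiter⟩
    have hbd := isBounded_cell hV hn hid
    rw [hab] at hbd hmem ⊢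
    exact isOpenPolygon_halfPlanes a b ⟨_, hmem⟩ hbd

/-! ### Lattice polygons -/

theorem cross_eq_mul (a b : Plane) (L : Plane →ₗ[ℝ] Plane) :
    cross (L a) (L b) = cross (L !₂[1, 0]) (L !₂[0, 1]) * cross a b := by
  have h : ∀ a : Plane, L a = a 0 • L !₂[1, 0] + a 1 • L !₂[0, 1] := by
    intro a
    rw [← map_smul, ← map_smul, ← map_add]
    congr 1
    ext i
    fin_cases i <;> simp
  rw [h a, h b]
  simp only [cross, PiLp.add_apply, PiLp.smul_apply, smul_eq_mul]
  ring

theorem exists_common_denominator {ι : Type*} {S : Set ι} (hS : S.Finite) (f : ι → ℝ)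
    (hf : ∀ i ∈ S, ∃ q : ℚ, f i = q) : ∃ m : ℕ, 0 < m ∧ ∀ i ∈ S, ∃ k : ℤ, m * f i = k := by
  induction S, hS using Set.Finite.induction_on with
  | empty => exact ⟨1, one_pos, by simp⟩
  | @insert i S _ _ ih =>
    obtain ⟨m, hm, h⟩ := ih fun j hj => hf j (mem_insert_of_mem i hj)
    obtain ⟨q, hq⟩ := hf i (mem_insert i S)
    refine ⟨m * q.den, Nat.mul_pos hm q.den_pos, ?_⟩
    rintro j (rfl | hj)
    · refine ⟨m * q.num, ?_⟩
      rw [hq]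
      have h1 : (q.den : ℝ) * (q : ℝ) = q.num := by exact_mod_cast q.den_mul_eq_num
      push_cast
      rw [mul_assoc, h1]
    · obtain ⟨k, hk⟩ := h j hj
      refine ⟨k * q.den, ?_⟩
      push_cast
      rw [← hk]
      ring

theorem IsLatticePolygon.exists_areaDiscrete {V : Set Plane} (h : IsLatticePolygon V) :
    ∃ δ : ℝ, 0 < δ ∧ AreaDiscrete V δ := by
  obtain ⟨hV, f, hf⟩ := h
  obtain ⟨m, hm, hk⟩ := exists_common_denominator (hV.finite.prod (finite_univ (α := Fin 2)))
    (fun p => f p.1 p.2) (fun p hp => hf p.1 hp.1 p.2)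
  have hk' : ∀ v ∈ V, ∀ i, ∃ k : ℤ, m * f v i = k := fun v hv i => hk (v, i) ⟨hv, mem_univ i⟩
  set D := cross (f.linear !₂[1, 0]) (f.linear !₂[0, 1]) with hD
  have hcross : ∀ a b, cross (f.linear a) (f.linear b) = D * cross a b := fun a b =>
    cross_eq_mul a b f.linear.toLinearMap
  have hD0 : D ≠ 0 := by
    intro h0
    have h1 := hcross (f.linear.symm !₂[1, 0]) (f.linear.symm !₂[0, 1])
    rw [LinearEquiv.apply_symm_apply, LinearEquiv.apply_symm_apply, h0, zero_mul] at h1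
    simp [cross] at h1
  have hm' : (0 : ℝ) < m := by exact_mod_cast hm
  have hint : ∀ p ∈ V, ∀ q ∈ V, ∀ r ∈ V, ∀ s ∈ V,
      ∃ k : ℤ, m ^ 2 * D * cross (p - q) (r - s) = k := by
    intro p hp q hq r hr s hs
    obtain ⟨p0, hp0⟩ := hk' p hp 0
    obtain ⟨p1, hp1⟩ := hk' p hp 1
    obtain ⟨q0, hq0⟩ := hk' q hq 0
    obtain ⟨q1, hq1⟩ := hk' q hq 1
    obtain ⟨r0, hr0⟩ := hk' r hr 0
    obtain ⟨r1, hr1⟩ := hk' r hr 1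
    obtain ⟨s0, hs0⟩ := hk' s hs 0
    obtain ⟨s1, hs1⟩ := hk' s hs 1
    refine ⟨(p0 - q0) * (r1 - s1) - (p1 - q1) * (r0 - s0), ?_⟩
    have e : ∀ x y, f.linear (x - y) = f x - f y := fun x y => f.toAffineMap.linearMap_vsub x y
    rw [mul_assoc, ← hcross, e, e]
    push_cast
    rw [← hp0, ← hp1, ← hq0, ← hq1, ← hr0, ← hr1, ← hs0, ← hs1]
    simp only [cross, PiLp.sub_apply]
    ring
  refine ⟨1 / |m ^ 2 * D|, by positivity, fun p hp q hq r hr s hs => ?_⟩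
  obtain ⟨k, hk⟩ := hint p hp q hq r hr s hs
  rcases lt_or_gt_of_ne hD0 with hneg | hpos
  · refine ⟨-k, ?_⟩
    have : (m : ℝ) ^ 2 * D < 0 := mul_neg_of_pos_of_neg (by positivity) hneg
    rw [abs_of_neg this]
    push_cast
    rw [← hk]
    field_simp
  · refine ⟨k, ?_⟩
    rw [abs_of_pos (by positivity), ← hk]
    field_simp

/-- The coordinates with respect to the basis `a`, `b` of the plane. -/
noncomputable def coordEquiv (a b : Plane) (h : cross a b ≠ 0) : Plane ≃ₗ[ℝ] Plane where
  toFun x := !₂[cross x b / cross a b, cross a x / cross a b]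
  invFun y := y 0 • a + y 1 • b
  map_add' x y := by
    ext i
    fin_cases i <;> simp [cross_add_left, cross_add_right, add_div]
  map_smul' t x := by
    ext i
    fin_cases i <;> simp [cross_smul_left, cross_smul_right, mul_div_assoc]
  left_inv x := by
    have h1 := cross_smul_add_cross_smul_add_cross_smul a b x
    have h2 : x = (cross a b)⁻¹ • (cross x b • a + cross a x • b) := by
      rw [eq_inv_smul_iff₀ h, ← sub_eq_zero, ← h1, cross_swap x b, cross_swap a x]
      module
    conv_rhs => rw [h2]
    simp [div_eq_inv_mul, mul_smul]
  right_inv y := by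
    ext i
    fin_cases i <;>
      simp [cross_add_left, cross_add_right, cross_smul_left, cross_smul_right, cross_self, h]

theorem IsConvexPolygon.isLatticePolygon {V : Set Plane} (hV : IsConvexPolygon V) {a b c : Plane}
    (hab : cross a b ≠ 0) (h : ∀ v ∈ V, ∃ s t : ℚ, v = c + ((s : ℝ) • a + (t : ℝ) • b)) :
    IsLatticePolygon V := by
  refine ⟨hV, (AffineEquiv.constVAdd ℝ Plane (-c)).trans (coordEquiv a b hab).toAffineEquiv,
    fun v hv i => ?_⟩
  obtain ⟨s, t, rfl⟩ := h v hv
  have e : ((AffineEquiv.constVAdd ℝ Plane (-c)).trans (coordEquiv a b hab).toAffineEquiv)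
      (c + ((s : ℝ) • a + (t : ℝ) • b)) = !₂[(s : ℝ), (t : ℝ)] := by
    change coordEquiv a b hab (-c + (c + ((s : ℝ) • a + (t : ℝ) • b))) = _
    rw [neg_add_cancel_left, ← LinearEquiv.eq_symm_apply]
    rfl
  rw [e]
  fin_cases i
  · exact ⟨s, rfl⟩
  · exact ⟨t, rfl⟩

/-! ### Regular polygons -/

/-- The `k`-th vertex of the regular `n`-gon with centre `0`, circumradius `1`, rotation `θ`. -/
noncomputable def unitVertex (n : ℕ) (θ : ℝ) (k : ℕ) : Plane :=
  !₂[Real.cos (θ + 2 * Real.pi * k / n), Real.sin (θ + 2 * Real.pi * k / n)]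

theorem unitVertex_add_two (n : ℕ) (θ : ℝ) (k : ℕ) : unitVertex n θ (k + 2) =
    (2 * Real.cos (2 * Real.pi / n)) • unitVertex n θ (k + 1) - unitVertex n θ k := by
  have e1 : θ + 2 * Real.pi * (k + 2 : ℕ) / n =
      (θ + 2 * Real.pi * (k + 1 : ℕ) / n) + 2 * Real.pi / n := by push_cast; ring
  have e2 : θ + 2 * Real.pi * k / n =
      (θ + 2 * Real.pi * (k + 1 : ℕ) / n) - 2 * Real.pi / n := by push_cast; ring
  unfold unitVertex
  rw [e1, e2]
  generalize θ + 2 * Real.pi * (k + 1 : ℕ) / n = α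
  generalize 2 * Real.pi / n = β
  rw [Real.cos_add, Real.cos_sub, Real.sin_add, Real.sin_sub]
  ext i
  fin_cases i
  · simp only [Fin.zero_eta, PiLp.sub_apply, PiLp.smul_apply, smul_eq_mul]
    simp
    ring
  · simp only [Fin.mk_one, PiLp.sub_apply, PiLp.smul_apply, smul_eq_mul]
    simp
    ring

theorem norm_unitVertex (n : ℕ) (θ : ℝ) (k : ℕ) : ‖unitVertex n θ k‖ = 1 := by
  rw [EuclideanSpace.norm_eq, Fin.sum_univ_two]
  simp [unitVertex]

theorem cross_unitVertex (n : ℕ) (θ : ℝ) :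
    cross (unitVertex n θ 0) (unitVertex n θ 1) = Real.sin (2 * Real.pi / n) := by
  have e : 2 * Real.pi / n =
      (θ + 2 * Real.pi * (1 : ℕ) / n) - (θ + 2 * Real.pi * (0 : ℕ) / n) := by push_cast; ring
  rw [e, Real.sin_sub]
  simp only [cross, unitVertex]
  simp
  ring

theorem exists_unitVertex_eq {n : ℕ} {m : ℤ} (hm : 2 * Real.cos (2 * Real.pi / n) = m) (θ : ℝ)
    (k : ℕ) : ∃ s t : ℚ, unitVertex n θ k =
      (s : ℝ) • unitVertex n θ 0 + (t : ℝ) • unitVertex n θ 1 := by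
  induction k using Nat.twoStepInduction with
  | zero => exact ⟨1, 0, by simp⟩
  | one => exact ⟨0, 1, by simp⟩
  | more k ih1 ih2 =>
    obtain ⟨s, t, h⟩ := ih1
    obtain ⟨s', t', h'⟩ := ih2
    refine ⟨m * s' - s, m * t' - t, ?_⟩
    rw [unitVertex_add_two, hm, h, h']
    push_cast
    module

theorem IsRegularPolygon.isLatticePolygon {n : ℕ} (hn : 3 ≤ n) {m : ℤ}
    (hm : 2 * Real.cos (2 * Real.pi / n) = m) {V : Set Plane} (h : IsRegularPolygon n V) :
    IsLatticePolygon V := by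
  obtain ⟨c, r, θ, hr, hV⟩ := h
  have hV : V = range fun k : Fin n => c + r • unitVertex n θ k := hV
  have hsin : 0 < Real.sin (2 * Real.pi / n) := by
    have hn' : (3 : ℝ) ≤ n := by exact_mod_cast hn
    have hpi := Real.pi_pos
    apply Real.sin_pos_of_pos_of_lt_pi (by positivity)
    rw [div_lt_iff₀ (by positivity)]
    nlinarith
  have hcos : Real.cos (2 * Real.pi / n) < 1 := by
    have := Real.sin_sq_add_cos_sq (2 * Real.pi / n)
    nlinarith
  have hcross := cross_unitVertex n θ
  have hmem : ∀ k < n, c + r • unitVertex n θ k ∈ V := fun k hk => hV ▸ ⟨⟨k, hk⟩, rfl⟩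
  have hpoly : IsConvexPolygon V := by
    refine ⟨hV ▸ finite_range _, ?_, fun hcol => ?_⟩
    · have hsub : V ⊆ (Metric.closedBall c r).extremePoints ℝ := by
        rw [hV]
        rintro _ ⟨k, rfl⟩
        refine StrictConvexSpace.sphere_subset_extremePoints_closedBall c hr.ne' ?_
        rw [mem_sphere_iff_norm, add_sub_cancel_left, norm_smul, norm_unitVertex, mul_one,
          Real.norm_eq_abs, abs_of_pos hr]
      exact (convex_closedBall c r).convexIndependent_extremePoints.mono hsub
    · have h1 := hcol.cross_eq_zero (hmem 0 (by omega)) (hmem 1 (by omega)) (hmem 2 (by omega))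
      rw [unitVertex_add_two n θ 0, zero_add] at h1
      have h2 : r ^ 2 * ((2 - 2 * Real.cos (2 * Real.pi / n)) *
          Real.sin (2 * Real.pi / n)) = 0 := by
        rw [← h1, ← hcross]
        simp only [cross, PiLp.add_apply, PiLp.sub_apply, PiLp.smul_apply, smul_eq_mul]
        ring
      have h3 : 0 < 2 - 2 * Real.cos (2 * Real.pi / n) := by linarith
      have h4 : 0 < r ^ 2 * ((2 - 2 * Real.cos (2 * Real.pi / n)) *
        Real.sin (2 * Real.pi / n)) := by positivity
      exact h4.ne' h2
  refine hpoly.isLatticePolygon (a := r • unitVertex n θ 0) (b := r • unitVertex n θ 1) (c := c)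
    ?_ ?_
  · rw [cross_smul_left, cross_smul_right, hcross]
    positivity
  · rw [hV]
    rintro _ ⟨k, rfl⟩
    obtain ⟨s, t, h1⟩ := exists_unitVertex_eq hm θ k
    refine ⟨s, t, ?_⟩
    show c + r • unitVertex n θ k = _
    rw [h1]
    module

end OuterBilliard

theorem mainTheorem4 :
    (∀ V : Set OuterBilliard.Plane, OuterBilliard.IsLatticePolygon V →
      (∀ x ∈ OuterBilliard.exterior V,
        x ∉ OuterBilliard.finitePoints V → x ∈ OuterBilliard.periodicPoints V) ∧
      (∀ C : Set OuterBilliard.Plane, OuterBilliard.IsComponent V C →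
        OuterBilliard.IsOpenPolygon C ∧ C ⊆ OuterBilliard.periodicPoints V ∧
        ∃ n : ℕ, 0 < n ∧ ∀ y ∈ C, OuterBilliard.iterT V n y = some y)) ∧
    (∀ (n : ℕ) (V : Set OuterBilliard.Plane), n = 3 ∨ n = 4 ∨ n = 6 →
      OuterBilliard.IsRegularPolygon n V → OuterBilliard.IsLatticePolygon V) := by
  refine ⟨fun V hV => ?_, fun n V hn h => ?_⟩
  · obtain ⟨δ, hδ, hd⟩ := hV.exists_areaDiscrete
    exact hd.periodic hV.1 hδ
  · rcases hn with rfl | rfl | rfl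
    · refine h.isLatticePolygon (m := -1) (by norm_num) ?_
      rw [show 2 * Real.pi / (3 : ℕ) = Real.pi - Real.pi / 3 by push_cast; ring,
        Real.cos_pi_sub, Real.cos_pi_div_three]
      norm_num
    · refine h.isLatticePolygon (m := 0) (by norm_num) ?_
      rw [show 2 * Real.pi / (4 : ℕ) = Real.pi / 2 by push_cast; ring, Real.cos_pi_div_two]
      norm_num
    · refine h.isLatticePolygon (m := 1) (by norm_num) ?_
      rw [show 2 * Real.pi / (6 : ℕ) = Real.pi / 3 by push_cast; ring, Real.cos_pi_div_three]
      norm_num
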